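/- Let $d\in\{1,2\}$. A convex body in $\mathbb{R}^d$ is a convex, compact set with nonempty interior. Let $\Lambda\subset\mathbb{R}^d$ be a lattice (a discrete subgroup that spans $\mathbb{R}^d$), let $e^1,\dots,e^d$ be a basis of $\Lambda$, and for $0\le i\le d$ let $\Lambda^i$ be the $\mathbb{Z}$-span of $0,e^1,\dots,e^i$ (so $\Lambda^0=\{0\}$). Let $K_1,\dots,K_n\subset\mathbb{R}^d$ be convex bodies and let $q_1\ge q_2\ge\dots\ge q_{d+1}$ be positive integers such that (1) $(K_j-K_j)\cap q_i(\Lambda\setminus\Lambda^{i-1})=\varnothing$ for all $1\le j\le n$ and $1\le i\le d$; (2) $(K_j-K_l)\cap q_{d+1}\Lambda=\varnothing$ for all $1\le j,l\le n$ with $j\ne l$, where $A-B=\{a-b : a\in A,\ b\in B\}$. Then $$\sum_{j=1}^n \#(K_j\cap\Lambda)\le\prod_{i=1}^d q_i .$$ -/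

import Mathlib

open scoped Pointwise

namespace LatticeConvex

/-- A convex body in `ℝ^d`: a convex, compact set with nonempty interior. -/
structure IsConvexBody {d : ℕ} (K : Set (EuclideanSpace ℝ (Fin d))) : Prop where
  convex : Convex ℝ K
  isCompact : IsCompact K
  interior_nonempty : (interior K).Nonempty

/-- The difference body `K - K = {x - y | x, y ∈ K}`. -/
def differenceBody {d : ℕ} (K : Set (EuclideanSpace ℝ (Fin d))) :
    Set (EuclideanSpace ℝ (Fin d)) :=
  K - K

/-- The lattice point enumerator: the number of points of `Λ` in `K`, as an extended natural
number (so that an infinite intersection would be counted as `⊤`). -/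
noncomputable def latticeCount {d : ℕ} (K : Set (EuclideanSpace ℝ (Fin d)))
    (Λ : Submodule ℤ (EuclideanSpace ℝ (Fin d))) : ℕ∞ :=
  (K ∩ (Λ : Set (EuclideanSpace ℝ (Fin d)))).encard

/-- The subgroup of `Λ` spanned over `ℤ` by the first `m` vectors of the basis `e`
(the zero subgroup for `m = 0`). -/
def initialSublattice {d : ℕ} {Λ : Submodule ℤ (EuclideanSpace ℝ (Fin d))}
    (e : Module.Basis (Fin d) ℤ Λ) (m : ℕ) : Submodule ℤ (EuclideanSpace ℝ (Fin d)) :=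
  Submodule.span ℤ {x | ∃ k : Fin d, (k : ℕ) < m ∧ x = (e k : EuclideanSpace ℝ (Fin d))}

end LatticeConvex

namespace LatticeConvex

/-! In coordinates of the basis the lattice is `ℤ²`. Write `q₁ ≥ q₂ ≥ q₃` and call a difference of
two points of one set lying in `r • ℤ²` and nonzero an `r`-overlap. The hypotheses say that no set
has a `q₁`-overlap, that every `q₂`-overlap is horizontal, and that different sets are disjoint
modulo `q₃ • ℤ²`.

Suppose two different sets have `q₃`-overlaps. Overlaps in non-parallel directions are closed loops
on the torus `ℝ² / q₃ℤ²` that must cross, so disjointness makes all overlaps parallel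
(`det_eq_zero_of_overlaps`). After a unimodular change they are horizontal, and each of the `q₃`
classes of rows carries at most `q₁` points (`card_le_of_parallel`), giving `q₁ * q₃`.

Otherwise at most one set `K` has `q₃`-overlaps. The points of the other sets are then pairwise
incongruent modulo `q₃`, and `K` misses all their residue classes: they are "holes" of `K`. The
claim becomes a bound on points of `K` plus holes (`card_add_card_holes_le`). In suitable
coordinates `K` has height below `2 * q₂` (`exists_overlap_of_tall`), so its lattice rows fold onto
`q₂` rows, at most two on each. The holes are folded onto the same rows, and each row receives at
most `q₁` points and holes (`card_rows_add_card_holes_le`).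

In dimension one a single row class suffices. -/

/-! ### Counting residues along rows. -/

theorem card_le_of_injOn_emod {α : Type*} (S : Finset α) (f : α → ℤ) {q : ℕ} (hq : 0 < q)
    (h : ∀ s ∈ S, ∀ t ∈ S, (q : ℤ) ∣ f s - f t → s = t) : S.card ≤ q := by
  have : S.card ≤ (Finset.Ico (0 : ℤ) q).card := by
    refine Finset.card_le_card_of_injOn (fun s => f s % q) ?_ ?_
    · intro s _
      have h1 := Int.emod_nonneg (f s) (b := q) (by positivity)
      have h2 := Int.emod_lt_of_pos (f s) (b := q) (by positivity)
      simpa using ⟨h1, h2⟩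
    · intro s hs t ht hst
      exact h s hs t ht (Int.ModEq.dvd (Int.ModEq.symm hst))
  simpa using this

/-- A convex planar set contains the point of a horizontal segment between two of its points. -/
theorem mem_of_row_between {K : Set (ℝ × ℝ)} (hK : Convex ℝ K) {x x' t y : ℝ}
    (hx : (x, y) ∈ K) (hx' : (x', y) ∈ K) (h1 : x ≤ t) (h2 : t ≤ x') : (t, y) ∈ K := by
  have hc : Convex ℝ {s : ℝ | (s, y) ∈ K} := by
    intro a ha b hb α β hα hβ hαβ
    have := hK ha hb hα hβ hαβ
    have e : α • (a, y) + β • (b, y) = (α • a + β • b, y) := by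
      ext
      · simp
      · simp [← add_mul, hαβ]
    rw [e] at this
    exact this
  exact hc.ordConnected.out hx hx' ⟨h1, h2⟩

/-- Points with abscissae congruent modulo `q` must share both their set and their row. If all of
`S` is one row of one set, abscissae are distinct modulo `Q`; otherwise they are distinct even
modulo `q`, because a row with two points `q` or more apart would meet a translate of any point
outside it. -/
theorem card_le_of_row_class {ι : Type*} (K : ι → Set (ℝ × ℝ)) (hconv : ∀ j, Convex ℝ (K j))
    {q Q : ℕ} (hq0 : 0 < q) (hqQ : q ≤ Q)
    (hQ : ∀ j, ∀ u ∈ K j, ∀ v ∈ K j, ∀ a : ℤ, u.1 = v.1 + Q * a → u.2 = v.2 → a = 0)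
    (hq : ∀ j, ∀ u ∈ K j, ∀ v ∈ K j, ∀ a b : ℤ, u.1 = v.1 + q * a → u.2 = v.2 + q * b → b = 0)
    (hd : ∀ j l, j ≠ l → ∀ u ∈ K j, ∀ v ∈ K l, ∀ a b : ℤ,
      u.1 = v.1 + q * a → u.2 = v.2 + q * b → False)
    (c : ℤ) (S : Finset (ι × ℤ × ℤ)) (hS : ∀ s ∈ S, ((s.2.1 : ℝ), (s.2.2 : ℝ)) ∈ K s.1)
    (hc : ∀ s ∈ S, (q : ℤ) ∣ s.2.2 - c) : S.card ≤ Q := by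
  have key : ∀ s ∈ S, ∀ t ∈ S, (q : ℤ) ∣ s.2.1 - t.2.1 → s.1 = t.1 ∧ s.2.2 = t.2.2 := by
    rintro s hs t ht ⟨a, ha⟩
    obtain ⟨b, hb⟩ := dvd_sub (hc s hs) (hc t ht)
    have ha' : (s.2.1 : ℝ) = t.2.1 + q * a := by
      have : s.2.1 = t.2.1 + q * a := by linarith
      exact_mod_cast this
    have hb0 : s.2.2 = t.2.2 + q * b := by linarith
    have hb' : (s.2.2 : ℝ) = t.2.2 + q * b := by exact_mod_cast hb0
    by_cases hj : s.1 = t.1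
    · refine ⟨hj, ?_⟩
      have h1 := hS s hs
      rw [hj] at h1
      have := hq t.1 _ h1 _ (hS t ht) a b ha' hb'
      rw [this] at hb0
      simpa using hb0
    · exact (hd _ _ hj _ (hS s hs) _ (hS t ht) a b ha' hb').elim
  by_cases hrow : ∀ s ∈ S, ∀ t ∈ S, s.1 = t.1 ∧ s.2.2 = t.2.2
  · refine card_le_of_injOn_emod S (fun s => s.2.1) (hq0.trans_le hqQ) ?_
    rintro s hs t ht ⟨a, ha⟩
    obtain ⟨hj, hy⟩ := hrow s hs t ht
    have ha0 : s.2.1 = t.2.1 + Q * a := by linarith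
    have h1 := hS s hs
    rw [hj] at h1
    have ha' : (s.2.1 : ℝ) = t.2.1 + Q * a := by exact_mod_cast ha0
    have := hQ t.1 _ h1 _ (hS t ht) a ha' (by simp [hy])
    rw [this] at ha0
    refine Prod.ext hj (Prod.ext (by simpa using ha0) hy)
  · refine le_trans (card_le_of_injOn_emod S (fun s => s.2.1) hq0 ?_) hqQ
    have wlog' : ∀ s ∈ S, ∀ t ∈ S, (q : ℤ) ∣ s.2.1 - t.2.1 → s.2.1 ≤ t.2.1 := by
      intro s hs t ht hst
      by_contra hlt
      push Not at hlt
      obtain ⟨hj, hy⟩ := key s hs t ht hst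
      have hge : t.2.1 + q ≤ s.2.1 := by
        have := Int.le_of_dvd (by linarith) hst
        linarith
      obtain ⟨r, hr, hne⟩ : ∃ r ∈ S, ¬ (r.1 = t.1 ∧ r.2.2 = t.2.2) := by
        by_contra hall
        push Not at hall
        apply hrow
        intro a ha b hb
        have h1 := hall a ha
        have h2 := hall b hb
        exact ⟨h1.1.trans h2.1.symm, h1.2.trans h2.2.symm⟩
      -- Translating `r` by `-q * e` puts its abscissa in `[t, t + q)`, hence between `t` and `s`;
      -- by convexity the translate, moved to their row, lies in `K t.1`.
      set e := (r.2.1 - t.2.1) / (q : ℤ) with he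
      have hdm := Int.emod_add_mul_ediv (r.2.1 - t.2.1) q
      have hm0 := Int.emod_nonneg (r.2.1 - t.2.1) (b := q) (by positivity)
      have hm1 := Int.emod_lt_of_pos (r.2.1 - t.2.1) (b := q) (by positivity)
      set x : ℤ := r.2.1 - q * e with hx
      have hx1 : t.2.1 ≤ x := by rw [hx]; linarith
      have hx2 : x ≤ s.2.1 := by rw [hx]; linarith
      have h1 := hS s hs
      rw [hj, hy] at h1
      have hmem : ((x : ℝ), (t.2.2 : ℝ)) ∈ K t.1 :=
        mem_of_row_between (hconv _) (hS t ht) h1 (by exact_mod_cast hx1) (by exact_mod_cast hx2)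
      obtain ⟨b, hb⟩ := dvd_sub (hc r hr) (hc t ht)
      have hb0 : r.2.2 = t.2.2 + q * b := by linarith
      have e1 : (r.2.1 : ℝ) = x + q * e := by
        have : r.2.1 = x + q * e := by rw [hx]; ring
        exact_mod_cast this
      have e2 : (r.2.2 : ℝ) = t.2.2 + q * b := by exact_mod_cast hb0
      by_cases hrj : r.1 = t.1
      · have h2 := hS r hr
        rw [hrj] at h2
        have := hq _ _ h2 _ hmem e b e1 e2
        rw [this] at hb0
        exact hne ⟨hrj, by simpa using hb0⟩
      · exact hd _ _ hrj _ (hS r hr) _ hmem e b e1 e2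
    intro s hs t ht hst
    obtain ⟨hj, hy⟩ := key s hs t ht hst
    have := wlog' s hs t ht hst
    have := wlog' t ht s hs (by rwa [dvd_sub_comm])
    exact Prod.ext hj (Prod.ext (by linarith) hy)

theorem card_le_of_parallel {ι : Type*} (K : ι → Set (ℝ × ℝ)) (hconv : ∀ j, Convex ℝ (K j))
    {q Q : ℕ} (hq0 : 0 < q) (hqQ : q ≤ Q)
    (hQ : ∀ j, ∀ u ∈ K j, ∀ v ∈ K j, ∀ a : ℤ, u.1 = v.1 + Q * a → u.2 = v.2 → a = 0)
    (hq : ∀ j, ∀ u ∈ K j, ∀ v ∈ K j, ∀ a b : ℤ, u.1 = v.1 + q * a → u.2 = v.2 + q * b → b = 0)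
    (hd : ∀ j l, j ≠ l → ∀ u ∈ K j, ∀ v ∈ K l, ∀ a b : ℤ,
      u.1 = v.1 + q * a → u.2 = v.2 + q * b → False)
    (S : Finset (ι × ℤ × ℤ)) (hS : ∀ s ∈ S, ((s.2.1 : ℝ), (s.2.2 : ℝ)) ∈ K s.1) :
    S.card ≤ Q * q := by
  classical
  have h := Finset.card_le_mul_card_image_of_maps_to (s := S) (t := Finset.Ico (0 : ℤ) q)
    (f := fun s => s.2.2 % (q : ℤ)) (fun s _ => by
      have h1 := Int.emod_nonneg s.2.2 (b := q) (by positivity)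
      have h2 := Int.emod_lt_of_pos s.2.2 (b := q) (by positivity)
      simpa using ⟨h1, h2⟩) Q (fun c _ => by
      refine card_le_of_row_class K hconv hq0 hqQ hQ hq hd c _ (fun s hs => hS s ?_) ?_
      · exact (Finset.mem_filter.1 hs).1
      · intro s hs
        have := (Finset.mem_filter.1 hs).2
        rw [← this]
        exact Int.dvd_self_sub_emod)
  simpa using h

/-! ### One set and its holes: two rows at distance `q₂`. -/

/-- Intervals `I`, `I'` inside a window of length `p`, and an interval `J` such that the
contraction of `J` by `p / q` towards any point of `I` lies in `I'`. -/
theorem card_row_hole_le {p q : ℕ} (hpq : p ≤ q) (hp : 0 < p) (g : ℤ) {I I' J : Set ℝ}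
    (hI' : I'.OrdConnected) (hJ : J.OrdConnected)
    (hIw : I ⊆ Set.Ioo (g : ℝ) (g + p)) (hIw' : I' ⊆ Set.Ioo (g : ℝ) (g + p))
    (hne : I.Nonempty)
    (hcomb : ∀ x ∈ I, ∀ t ∈ J, ((q - p) * x + p * t) / q ∈ I')
    (hdis : ∀ x ∈ I, ∀ t ∈ J, ∀ a : ℤ, t - x ≠ q * a)
    (A B C : Finset ℤ) (hA : ∀ n ∈ A, (n : ℝ) ∈ I) (hB : ∀ n ∈ B, (n : ℝ) ∈ J)
    (hC : ∀ n ∈ C, g ≤ n ∧ n < g + p) (hCI : ∀ n ∈ C, (n : ℝ) ∉ I)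
    (hCI' : ∀ n ∈ C, (n : ℝ) ∉ I') : A.card + B.card + C.card ≤ q := by
  classical
  have hpR : (0 : ℝ) < p := by exact_mod_cast hp
  have hqR : (0 : ℝ) < q := by exact_mod_cast hp.trans_le hpq
  have hpqR : (p : ℝ) ≤ q := by exact_mod_cast hpq
  have hlt : ∀ x ∈ I, ∀ t ∈ J, |t - x| < q := by
    intro x hx t ht
    have h1 := hIw hx
    have h2 := hIw' (hcomb x hx t ht)
    have e : ((q - p) * x + p * t) / q = x + p * ((t - x) / q) := by field_simp; ring
    rw [e] at h2
    have h3 : |p * ((t - x) / q)| < p * 1 := by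
      rw [abs_lt]; constructor <;> linarith [h1.1, h1.2, h2.1, h2.2]
    rw [abs_mul, abs_of_pos hpR] at h3
    have h4 := lt_of_mul_lt_mul_left h3 hpR.le
    rw [abs_div, abs_of_pos hqR, div_lt_one hqR] at h4
    exact h4
  have hIJ : ∀ x ∈ I, x ∉ J := fun x hx hxJ => hdis x hx x hxJ 0 (by simp)
  obtain ⟨x₀, hx₀⟩ := hne
  -- integers of `B` away from one end lie in `I'`
  obtain ⟨B', hB'B, hB'I, hcard⟩ : ∃ B' ⊆ B, (∀ n ∈ B', (n : ℝ) ∈ I') ∧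
      B.card ≤ B'.card + (q - p) := by
    rcases B.eq_empty_or_nonempty with rfl | hBne
    · exact ⟨∅, by simp, by simp, by simp⟩
    set s := B.min' hBne with hs
    set t := B.max' hBne with ht
    have hsB := B.min'_mem hBne
    have htB := B.max'_mem hBne
    have hsJ : (s : ℝ) ∈ J := hB _ hsB
    have htJ : (t : ℝ) ∈ J := hB _ htB
    have hst : ∀ n ∈ B, s ≤ n ∧ n ≤ t := fun n hn => ⟨B.min'_le n hn, B.le_max' n hn⟩
    have hδ : ((q - p : ℕ) : ℤ) = (q : ℤ) - p := by push_cast [hpq]; ring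
    have e : ∀ y : ℝ, ((q - p) * x₀ + p * y) / q = y - (q - p) * ((y - x₀) / q) := by
      intro y; field_simp; ring
    have hfs := hcomb x₀ hx₀ s hsJ
    have hft := hcomb x₀ hx₀ t htJ
    rw [e] at hfs hft
    have hls := abs_lt.1 (hlt x₀ hx₀ s hsJ)
    have hlt' := abs_lt.1 (hlt x₀ hx₀ t htJ)
    have b1 : ((t : ℝ) - x₀) / q ≤ 1 := by rw [div_le_one hqR]; linarith
    have b2 : -1 ≤ ((s : ℝ) - x₀) / q := by rw [le_div_iff₀ hqR]; linarith
    have hqp : (0 : ℝ) ≤ q - p := by linarith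
    -- As `J` misses `x₀`, it lies on one side of it. The contraction moves every point of `J`
    -- towards `x₀` by at most `q - p`, so only the `q - p` integers at the end of `[s, t]` far from
    -- `x₀` can fall outside `I'`.
    by_cases hside : x₀ < s
    · have b3 : 0 ≤ ((s : ℝ) - x₀) / q := div_nonneg (by linarith) hqR.le
      refine ⟨B.filter (fun n => n ≤ t - (q - p)), Finset.filter_subset _ _, ?_, ?_⟩
      · intro n hn
        rw [Finset.mem_filter] at hn
        have h1 : (s : ℝ) ≤ n := by exact_mod_cast (hst n hn.1).1
        have h2 : (n : ℝ) ≤ t - (q - p) := by exact_mod_cast hn.2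
        exact hI'.out hfs hft ⟨by nlinarith, by nlinarith⟩
      · rw [← Finset.card_filter_add_card_filter_not (s := B) (fun n => n ≤ t - ((q : ℤ) - p))]
        gcongr
        calc _ ≤ (Finset.Ioc (t - ((q : ℤ) - p)) t).card := by
              apply Finset.card_le_card
              intro n hn
              rw [Finset.mem_filter] at hn
              rw [Finset.mem_Ioc]
              exact ⟨not_le.1 hn.2, (hst n hn.1).2⟩
          _ ≤ q - p := by rw [Int.card_Ioc]; omega
    · have htx : (t : ℝ) ≤ x₀ := by
        by_contra hcon
        push Not at hcon hside
        exact hIJ x₀ hx₀ (hJ.out hsJ htJ ⟨hside, hcon.le⟩)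
      have b3 : ((t : ℝ) - x₀) / q ≤ 0 := div_nonpos_of_nonpos_of_nonneg (by linarith) hqR.le
      refine ⟨B.filter (fun n => s + (q - p) ≤ n), Finset.filter_subset _ _, ?_, ?_⟩
      · intro n hn
        rw [Finset.mem_filter] at hn
        have h1 : (n : ℝ) ≤ t := by exact_mod_cast (hst n hn.1).2
        have h2 : (s : ℝ) + (q - p) ≤ n := by exact_mod_cast hn.2
        exact hI'.out hfs hft ⟨by nlinarith, by nlinarith⟩
      · rw [← Finset.card_filter_add_card_filter_not (s := B) (fun n => s + ((q : ℤ) - p) ≤ n)]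
        gcongr
        calc _ ≤ (Finset.Ico s (s + ((q : ℤ) - p))).card := by
              apply Finset.card_le_card
              intro n hn
              rw [Finset.mem_filter] at hn
              rw [Finset.mem_Ico]
              exact ⟨(hst n hn.1).1, not_le.1 hn.2⟩
          _ ≤ q - p := by rw [Int.card_Ico]; omega
  have hAB : Disjoint A B' := Finset.disjoint_left.2 fun n hn hn' =>
    hIJ _ (hA n hn) (hB n (hB'B hn'))
  have hABC : Disjoint (A ∪ B') C := Finset.disjoint_left.2 fun n hn hn' => by
    rcases Finset.mem_union.1 hn with h | h
    · exact hCI n hn' (hA n h)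
    · exact hCI' n hn' (hB'I n h)
  have hw : ((A ∪ B') ∪ C).card ≤ p := by
    calc _ ≤ (Finset.Ico g (g + p)).card := by
          apply Finset.card_le_card
          intro n hn
          rw [Finset.mem_Ico]
          rcases Finset.mem_union.1 hn with h | h
          · have : (n : ℝ) ∈ Set.Ioo (g : ℝ) (g + p) := by
              rcases Finset.mem_union.1 h with h | h
              · exact hIw (hA n h)
              · exact hIw' (hB'I n h)
            exact ⟨by exact_mod_cast this.1.le, by exact_mod_cast this.2⟩
          · exact hC n h
      _ = p := by simp
  rw [Finset.card_union_of_disjoint hABC, Finset.card_union_of_disjoint hAB] at hw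
  omega

theorem row_ordConnected {K : Set (ℝ × ℝ)} (hK : Convex ℝ K) (y c : ℝ) :
    {x : ℝ | (x + c, y) ∈ K}.OrdConnected :=
  ⟨fun _ hx _ hx' _ ht => mem_of_row_between hK hx hx' (by linarith [ht.1]) (by linarith [ht.2])⟩

theorem exists_window {I : Set ℝ} (hI : I.OrdConnected) (hne : I.Nonempty) {p : ℕ} (hp : 0 < p)
    (g : ℤ) (hg : ∀ a : ℤ, (g : ℝ) + p * a ∉ I) :
    ∃ a : ℤ, I ⊆ Set.Ioo ((g : ℝ) + p * a) (g + p * a + p) := by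
  have hpR : (0 : ℝ) < p := by exact_mod_cast hp
  obtain ⟨x, hx⟩ := hne
  set a := ⌊(x - g) / p⌋ with ha
  have h1 : (g : ℝ) + p * a ≤ x := by
    have := Int.floor_le ((x - g) / p)
    rw [← ha, le_div_iff₀ hpR] at this
    linarith
  have h2 : x < (g : ℝ) + p * a + p := by
    have := Int.lt_floor_add_one ((x - g) / p)
    rw [← ha, div_lt_iff₀ hpR] at this
    linarith
  have h3 : (g : ℝ) + p * a + p ∉ I := by
    have := hg (a + 1)
    push_cast at this
    rwa [mul_add, mul_one, ← add_assoc] at this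
  refine ⟨a, fun t ht => ⟨?_, ?_⟩⟩
  · by_contra hcon
    push Not at hcon
    exact hg a (hI.out ht hx ⟨hcon, h1⟩)
  · by_contra hcon
    push Not at hcon
    exact h3 (hI.out hx ht ⟨h2.le, hcon⟩)

/-- When row `y + q₂` is occupied, convexity with row `y` controls the slice at height `y + q₃`. A
hole class keeps that slice and row `y` each within a window of length `q₃`, which is the situation
of `card_row_hole_le`. When only row `y` is occupied, points and holes together are distinct modulo
`q₃`. With no holes, `card_le_of_row_class` applies. -/
theorem card_rows_add_card_holes_le {K : Set (ℝ × ℝ)} (hK : Convex ℝ K) {q₁ q₂ q₃ : ℕ}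
    (h3 : 0 < q₃) (h32 : q₃ ≤ q₂) (h21 : q₂ ≤ q₁)
    (hQ : ∀ u ∈ K, ∀ v ∈ K, ∀ a : ℤ, u.1 = v.1 + q₁ * a → u.2 = v.2 → a = 0)
    (hq : ∀ u ∈ K, ∀ v ∈ K, ∀ a b : ℤ, u.1 = v.1 + q₂ * a → u.2 = v.2 + q₂ * b → b = 0)
    (y : ℤ) (S P : Finset (ℤ × ℤ)) (hS : ∀ s ∈ S, ((s.1 : ℝ), (s.2 : ℝ)) ∈ K)
    (hP : ∀ p ∈ P, ∀ p' ∈ P, ∀ a b : ℤ, p.1 = p'.1 + q₃ * a → p.2 = p'.2 + q₃ * b → p = p')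
    (hPK : ∀ p ∈ P, ∀ a b : ℤ, ((p.1 : ℝ) + q₃ * a, (p.2 : ℝ) + q₃ * b) ∉ K)
    (hSy : ∀ s ∈ S, s.2 = y ∨ s.2 = y + q₂) (hPy : ∀ p ∈ P, (q₃ : ℤ) ∣ p.2 - y)
    (hrow : (∃ s ∈ S, s.2 = y + q₂) → P.Nonempty → ∃ x : ℝ, (x, (y : ℝ)) ∈ K) :
    S.card + P.card ≤ q₁ := by
  classical
  have h3R : (0 : ℝ) < q₃ := by exact_mod_cast h3
  have h2R : (0 : ℝ) < q₂ := by exact_mod_cast h3.trans_le h32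
  have h32R : (q₃ : ℝ) ≤ q₂ := by exact_mod_cast h32
  rcases P.eq_empty_or_nonempty with rfl | hPne
  · have := card_le_of_row_class (fun _ : Unit => K) (fun _ => hK) (h3.trans_le h32) h21
      (fun _ => hQ) (fun _ => hq) (fun j l h => (h rfl).elim) y
      (S.image (fun s => ((), s)))
      (by
        simp only [Finset.mem_image]
        rintro _ ⟨s, hs, rfl⟩
        exact hS s hs)
      (by
        simp only [Finset.mem_image]
        rintro _ ⟨s, hs, rfl⟩
        rcases hSy s hs with h | h <;> simp [h])
    rw [Finset.card_image_of_injective _ (fun a b h => (Prod.ext_iff.1 h).2)] at this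
    simpa using this
  by_cases htop : ∃ s ∈ S, s.2 = y + q₂
  · obtain ⟨x₁, hx₁⟩ := hrow htop hPne
    obtain ⟨s₁, hs₁, hs₁y⟩ := htop
    obtain ⟨p₀, hp₀⟩ := hPne
    obtain ⟨b₀, hb₀⟩ := hPy p₀ hp₀
    have hb₀' : (p₀.2 : ℝ) = y + q₃ * b₀ := by
      have : p₀.2 = y + q₃ * b₀ := by linarith
      exact_mod_cast this
    have hcomb : ∀ x t : ℝ, (x, (y : ℝ)) ∈ K → (t, (y : ℝ) + q₂) ∈ K →
        (((q₂ - q₃) * x + q₃ * t) / q₂, (y : ℝ) + q₃) ∈ K := by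
      intro x t hx ht
      have := hK hx ht (a := (q₂ - q₃) / q₂) (b := q₃ / q₂) (div_nonneg (by linarith) h2R.le)
        (by positivity) (by field_simp; ring)
      convert this using 1
      ext
      · simp; field_simp
      · simp; field_simp; ring
    have havoid : ∀ a b : ℤ, ((p₀.1 : ℝ) + q₃ * a, (y : ℝ) + q₃ * b) ∉ K := by
      intro a b
      have := hPK p₀ hp₀ a (b - b₀)
      rw [hb₀'] at this
      convert this using 3
      push_cast; ring
    obtain ⟨a, ha⟩ := exists_window (row_ordConnected hK y 0) ⟨x₁, by simpa using hx₁⟩ h3 p₀.1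
      (fun a => by simpa using havoid a 0)
    have hs₁K := hS s₁ hs₁
    rw [hs₁y] at hs₁K
    push_cast at hs₁K
    -- The slice at height `y + q₃` may lie in another window, `k` steps away. Shifting it by `q₃ *
    -- k` and the top row by `q₂ * k` aligns the windows and respects the contraction, whose ratio
    -- is `q₃ / q₂`.
    obtain ⟨k, hk⟩ := exists_window (row_ordConnected hK (y + q₃) 0)
      ⟨_, by simpa using hcomb x₁ s₁.1 hx₁ hs₁K⟩ h3 (p₀.1 + q₃ * a)
      (fun b => by simpa [mul_add, add_assoc] using havoid (a + b) 1)
    set g : ℤ := p₀.1 + q₃ * a with hg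
    have hgR : (g : ℝ) = p₀.1 + q₃ * a := by rw [hg]; push_cast; ring
    have hmain := card_row_hole_le h32 h3 g (I := {x : ℝ | (x + 0, (y : ℝ)) ∈ K})
      (I' := {x : ℝ | (x + q₃ * k, (y : ℝ) + q₃) ∈ K})
      (J := {x : ℝ | (x + q₂ * k, (y : ℝ) + q₂) ∈ K})
      (row_ordConnected hK _ _) (row_ordConnected hK _ _)
      (by rw [hgR]; exact ha)
      (by
        intro x hx
        have := hk (a := x + q₃ * k) (by simpa using hx)
        constructor <;> linarith [this.1, this.2])
      ⟨x₁, by simpa using hx₁⟩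
      (by
        intro x hx t ht
        have := hcomb x _ (by simpa using hx) ht
        simp only [Set.mem_ofPred_eq]
        convert this using 2
        field_simp; ring)
      (by
        intro x hx t ht b hb
        have hx' : (x, (y : ℝ)) ∈ K := by simpa using hx
        have := hq _ ht _ hx' (b + k) 1 (by push_cast; linarith) (by simp)
        omega)
      ((S.filter (fun s => s.2 = y)).image (fun s => s.1))
      ((S.filter (fun s => s.2 = y + q₂)).image (fun s => s.1 - q₂ * k))
      (P.image (fun p => g + (p.1 - g) % q₃))
      (by
        intro n hn
        simp only [Finset.mem_image, Finset.mem_filter] at hn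
        obtain ⟨s, ⟨hs, hsy⟩, rfl⟩ := hn
        have := hS s hs
        rw [hsy] at this
        simpa using this)
      (by
        intro n hn
        simp only [Finset.mem_image, Finset.mem_filter] at hn
        obtain ⟨s, ⟨hs, hsy⟩, rfl⟩ := hn
        have := hS s hs
        rw [hsy] at this
        push_cast at this
        simpa using this)
      (by
        intro n hn
        simp only [Finset.mem_image] at hn
        obtain ⟨p, hp, rfl⟩ := hn
        have h1 := Int.emod_nonneg (p.1 - g) (b := q₃) (by positivity)
        have h2 := Int.emod_lt_of_pos (p.1 - g) (b := q₃) (by positivity)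
        constructor <;> linarith)
      (by
        intro n hn
        simp only [Finset.mem_image] at hn
        obtain ⟨p, hp, rfl⟩ := hn
        obtain ⟨b, hb⟩ := hPy p hp
        have hpb : (p.2 : ℝ) = y + q₃ * b := by
          have : p.2 = y + q₃ * b := by linarith
          exact_mod_cast this
        have := hPK p hp (-((p.1 - g) / q₃)) (-b)
        rw [hpb] at this
        simp only [Set.mem_ofPred_eq, Int.emod_def]
        convert this using 3 <;> push_cast <;> ring)
      (by
        intro n hn
        simp only [Finset.mem_image] at hn
        obtain ⟨p, hp, rfl⟩ := hn
        obtain ⟨b, hb⟩ := hPy p hp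
        have hpb : (p.2 : ℝ) = y + q₃ * b := by
          have : p.2 = y + q₃ * b := by linarith
          exact_mod_cast this
        have := hPK p hp (k - ((p.1 - g) / q₃)) (1 - b)
        rw [hpb] at this
        simp only [Set.mem_ofPred_eq, Int.emod_def]
        convert this using 3 <;> push_cast <;> ring)
    rw [Finset.card_image_of_injOn, Finset.card_image_of_injOn, Finset.card_image_of_injOn]
      at hmain
    · have hsplit : S.card = (S.filter (fun s => s.2 = y)).card +
          (S.filter (fun s => s.2 = y + q₂)).card := by
        rw [← Finset.card_filter_add_card_filter_not (s := S) (fun s => s.2 = y)]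
        congr 2
        apply Finset.filter_congr
        intro s hs
        have : 0 < q₂ := h3.trans_le h32
        rcases hSy s hs with h | h <;> omega
      omega
    · intro p hp p' hp' hpp
      simp only [add_right_inj] at hpp
      obtain ⟨c, hc⟩ := Int.ModEq.dvd (Int.ModEq.symm hpp)
      obtain ⟨d, hd⟩ := dvd_sub (hPy p hp) (hPy p' hp')
      exact hP p hp p' hp' c d (by linarith) (by linarith)
    · intro s hs s' hs' h
      simp only [Finset.coe_filter, Set.mem_ofPred_eq] at hs hs'
      exact Prod.ext (by simpa using h) (hs.2.trans hs'.2.symm)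
    · intro s hs s' hs' h
      simp only [Finset.coe_filter, Set.mem_ofPred_eq] at hs hs'
      exact Prod.ext h (hs.2.trans hs'.2.symm)
  · push Not at htop
    have hSy' : ∀ s ∈ S, s.2 = y := fun s hs => (hSy s hs).resolve_right (htop s hs)
    rw [← Finset.card_disjSum]
    refine le_trans (card_le_of_injOn_emod _ (Sum.elim (fun s => s.1) (fun p => p.1)) h3 ?_)
      (h32.trans h21)
    have hsp : ∀ s ∈ S, ∀ p ∈ P, ¬ (q₃ : ℤ) ∣ s.1 - p.1 := by
      rintro s hs p hp ⟨a, ha⟩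
      obtain ⟨b, hb⟩ := hPy p hp
      have e1 : (s.1 : ℝ) = p.1 + q₃ * a := by
        have : s.1 = p.1 + q₃ * a := by linarith
        exact_mod_cast this
      have e2 : (s.2 : ℝ) = p.2 + q₃ * ((-b : ℤ) : ℝ) := by
        have : s.2 = p.2 + q₃ * (-b) := by rw [hSy' s hs]; linarith
        exact_mod_cast this
      have := hPK p hp a (-b)
      rw [← e1, ← e2] at this
      exact this (hS s hs)
    -- Two points of row `y` at distance at least `q₃` would have a translate of a hole between
    -- them.
    have hss : ∀ s ∈ S, ∀ s' ∈ S, (q₃ : ℤ) ∣ s.1 - s'.1 → s.1 ≤ s'.1 := by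
      intro s hs s' hs' hdiv
      by_contra hcon
      push Not at hcon
      have hge : s'.1 + q₃ ≤ s.1 := by
        have := Int.le_of_dvd (by linarith) hdiv
        linarith
      obtain ⟨p, hp⟩ := hPne
      obtain ⟨b, hb⟩ := hPy p hp
      set e := (p.1 - s'.1) / (q₃ : ℤ) with he
      have hdm := Int.emod_add_mul_ediv (p.1 - s'.1) q₃
      have hm0 := Int.emod_nonneg (p.1 - s'.1) (b := q₃) (by positivity)
      have hm1 := Int.emod_lt_of_pos (p.1 - s'.1) (b := q₃) (by positivity)
      have hK1 := hS s' hs'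
      have hK2 := hS s hs
      rw [hSy' s' hs'] at hK1
      rw [hSy' s hs] at hK2
      have e1 : s'.1 ≤ p.1 + q₃ * (-e) := by linarith
      have e2 : p.1 + q₃ * (-e) ≤ s.1 := by linarith
      have e3 : (p.2 : ℝ) = y + q₃ * b := by
        have : p.2 = y + q₃ * b := by linarith
        exact_mod_cast this
      have hmem := mem_of_row_between hK hK1 hK2 (t := (p.1 : ℝ) + q₃ * ((-e : ℤ) : ℝ))
        (by exact_mod_cast e1) (by exact_mod_cast e2)
      apply hPK p hp (-e) (-b)
      rw [e3]
      convert hmem using 2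
      push_cast; ring
    rintro (s | p) hs (s' | p') hs' hdiv
    · simp only [Finset.inl_mem_disjSum, Sum.elim_inl] at hs hs' hdiv
      have h1 := hss s hs s' hs' hdiv
      have h2 := hss s' hs' s hs (by rwa [dvd_sub_comm])
      rw [Prod.ext (le_antisymm h1 h2) ((hSy' s hs).trans (hSy' s' hs').symm)]
    · simp only [Finset.inl_mem_disjSum, Finset.inr_mem_disjSum, Sum.elim_inl, Sum.elim_inr]
        at hs hs' hdiv
      exact (hsp s hs p' hs' hdiv).elim
    · simp only [Finset.inl_mem_disjSum, Finset.inr_mem_disjSum, Sum.elim_inl, Sum.elim_inr]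
        at hs hs' hdiv
      exact (hsp s' hs' p hs (by rwa [dvd_sub_comm])).elim
    · simp only [Finset.inr_mem_disjSum, Sum.elim_inr] at hs hs' hdiv
      obtain ⟨c, hc⟩ := hdiv
      obtain ⟨d, hd⟩ := dvd_sub (hPy p hs) (hPy p' hs')
      rw [hP p hs p' hs' c d (by linarith) (by linarith)]

theorem card_le_sq_of_incongruent {q : ℕ} (hq : 0 < q) (P : Finset (ℤ × ℤ))
    (hP : ∀ p ∈ P, ∀ p' ∈ P, ∀ a b : ℤ, p.1 = p'.1 + q * a → p.2 = p'.2 + q * b → p = p') :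
    P.card ≤ q * q := by
  classical
  have h := Finset.card_le_mul_card_image_of_maps_to (s := P) (t := Finset.Ico (0 : ℤ) q)
    (f := fun s => s.2 % (q : ℤ)) (fun s _ => by
      have h1 := Int.emod_nonneg s.2 (b := q) (by positivity)
      have h2 := Int.emod_lt_of_pos s.2 (b := q) (by positivity)
      simpa using ⟨h1, h2⟩) q (fun c _ => by
      refine card_le_of_injOn_emod _ (fun s => s.1) hq ?_
      rintro s hs t ht ⟨a, ha⟩
      rw [Finset.mem_filter] at hs ht
      obtain ⟨b, hb⟩ := Int.ModEq.dvd (show t.2 % q = s.2 % q from ht.2.trans hs.2.symm)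
      exact hP s hs.1 t ht.1 a b (by linarith) (by linarith))
  simpa using h

/-- The height bound makes each class of rows modulo `q₂` meet `S` in at most two rows, `y` and `y +
q₂`. Summing the two-row bound over the `q₂` values of `y` gives the result. -/
theorem card_add_card_holes_le_of_height {K : Set (ℝ × ℝ)} (hK : Convex ℝ K) {q₁ q₂ q₃ : ℕ}
    (h3 : 0 < q₃) (h32 : q₃ ≤ q₂) (h21 : q₂ ≤ q₁)
    (hQ : ∀ u ∈ K, ∀ v ∈ K, ∀ a : ℤ, u.1 = v.1 + q₁ * a → u.2 = v.2 → a = 0)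
    (hq : ∀ u ∈ K, ∀ v ∈ K, ∀ a b : ℤ, u.1 = v.1 + q₂ * a → u.2 = v.2 + q₂ * b → b = 0)
    (hH : ∀ u ∈ K, ∀ v ∈ K, u.2 - v.2 < 2 * q₂)
    (S P : Finset (ℤ × ℤ)) (hS : ∀ s ∈ S, ((s.1 : ℝ), (s.2 : ℝ)) ∈ K)
    (hP : ∀ p ∈ P, ∀ p' ∈ P, ∀ a b : ℤ, p.1 = p'.1 + q₃ * a → p.2 = p'.2 + q₃ * b → p = p')
    (hPK : ∀ p ∈ P, ∀ a b : ℤ, ((p.1 : ℝ) + q₃ * a, (p.2 : ℝ) + q₃ * b) ∉ K) :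
    S.card + P.card ≤ q₁ * q₂ := by
  classical
  rcases S.eq_empty_or_nonempty with rfl | hSne
  · have := card_le_sq_of_incongruent h3 P hP
    have h1 : q₃ * q₃ ≤ q₁ * q₂ := Nat.mul_le_mul (h32.trans h21) h32
    simpa using this.trans h1
  obtain ⟨s₀, hs₀, hmin⟩ := S.exists_min_image (fun s => s.2) hSne
  set l := s₀.2 with hl
  have hup : ∀ s ∈ S, s.2 < l + 2 * q₂ := by
    intro s hs
    have := hH _ (hS s hs) _ (hS s₀ hs₀)
    simp only at this
    have h1 : (s.2 : ℝ) < s₀.2 + 2 * q₂ := by linarith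
    rw [hl]
    exact_mod_cast h1
  have h3Z : (0 : ℤ) < q₃ := by exact_mod_cast h3
  have h32Z : (q₃ : ℤ) ≤ q₂ := by exact_mod_cast h32
  -- Both maps fold into the rows `[l, l + q₂)`: points of `S` modulo `q₂`, and holes modulo `q₃`
  -- onto the last `q₃` of these rows.
  let fS : ℤ × ℤ → ℤ := fun s => if s.2 < l + q₂ then s.2 else s.2 - q₂
  let fP : ℤ × ℤ → ℤ := fun p => l + q₂ - 1 - (l + q₂ - 1 - p.2) % q₃
  have hfS : ∀ s ∈ S, l ≤ fS s ∧ fS s < l + q₂ ∧ (s.2 = fS s ∨ s.2 = fS s + q₂) := by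
    intro s hs
    have h1 := hmin s hs
    have h2 := hup s hs
    simp only [fS]
    split_ifs with h
    · exact ⟨h1, h, Or.inl rfl⟩
    · push Not at h
      exact ⟨by linarith, by linarith, Or.inr (by ring)⟩
  have hfP : ∀ p : ℤ × ℤ, l + q₂ - q₃ ≤ fP p ∧ fP p < l + q₂ ∧ (q₃ : ℤ) ∣ p.2 - fP p := by
    intro p
    have h1 := Int.emod_nonneg (l + q₂ - 1 - p.2) h3Z.ne'
    have h2 := Int.emod_lt_of_pos (l + q₂ - 1 - p.2) h3Z
    refine ⟨by simp only [fP]; linarith, by simp only [fP]; linarith, ?_⟩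
    rw [dvd_sub_comm]
    have e : fP p - p.2 = (l + q₂ - 1 - p.2) - (l + q₂ - 1 - p.2) % q₃ := by simp only [fP]; ring
    rw [e]
    exact Int.dvd_self_sub_emod
  rw [← Finset.card_disjSum]
  have h := Finset.card_le_mul_card_image_of_maps_to (s := S.disjSum P)
    (t := Finset.Ico l (l + q₂)) (f := Sum.elim fS fP)
    (by
      rintro (s | p) h
      · rw [Finset.inl_mem_disjSum] at h
        simpa using ⟨(hfS s h).1, (hfS s h).2.1⟩
      · have := hfP p
        simp only [Sum.elim_inr, Finset.mem_Ico]
        exact ⟨by linarith [this.1], this.2.1⟩)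
    q₁ (by
      intro y hy
      have e : (S.disjSum P).filter (fun z => Sum.elim fS fP z = y) =
          (S.filter (fun s => fS s = y)).disjSum (P.filter (fun p => fP p = y)) := by
        ext (s | p) <;> simp
      rw [e, Finset.card_disjSum]
      have hPm : ∀ p ∈ P.filter (fun p => fP p = y), p ∈ P ∧ fP p = y :=
        fun p hp => Finset.mem_filter.1 hp
      have hSm : ∀ s ∈ S.filter (fun s => fS s = y), s ∈ S ∧ fS s = y :=
        fun p hp => Finset.mem_filter.1 hp
      refine card_rows_add_card_holes_le hK h3 h32 h21 hQ hq y _ _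
        (fun s hs => hS s (hSm s hs).1)
        (fun p hp p' hp' => hP p (hPm p hp).1 p' (hPm p' hp').1)
        (fun p hp => hPK p (hPm p hp).1)
        (fun s hs => (hSm s hs).2 ▸ (hfS s (hSm s hs).1).2.2)
        (fun p hp => (hPm p hp).2 ▸ (hfP p).2.2) ?_
      rintro ⟨s, hs, hsy⟩ -
      rw [Finset.mem_Ico] at hy
      have hs' := hS s (hSm s hs).1
      have hs₀' := hS s₀ hs₀
      rw [hsy] at hs'
      have hly : (l : ℝ) ≤ y := by exact_mod_cast hy.1
      have hq2 : (0 : ℝ) < q₂ := by exact_mod_cast h3.trans_le h32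
      have hpos : (0 : ℝ) < y + q₂ - l := by linarith
      -- The segment from the lowest point `s₀`, at height `l ≤ y`, to `s`, at height `y + q₂`,
      -- crosses height `y`; these are the weights of the crossing point.
      have := hK hs₀' hs' (a := q₂ / (y + q₂ - l)) (b := (y - l) / (y + q₂ - l))
        (by positivity) (div_nonneg (by linarith) hpos.le) (by field_simp; ring)
      refine ⟨(q₂ / (y + q₂ - l)) * s₀.1 + ((y - l) / (y + q₂ - l)) * s.1, ?_⟩
      convert this using 1
      ext
      · simp
      · simp [← hl]; field_simp; ring)
  simpa using h

/-! ### Overlaps forced by height. -/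

/-- A planar convex set with a long horizontal chord and large height has a difference
of the form `ρ • (k, 1)` with `k` an integer. -/
theorem exists_overlap_of_tall {K : Set (ℝ × ℝ)} (hK : Convex ℝ K) {r H ρ : ℝ} (hr : 0 < r)
    (hρ : 0 < ρ) (hH : 0 < H) (hle : ρ * (H + 2 * r) ≤ 2 * r * H)
    {u v w z : ℝ × ℝ} (hu : u ∈ K) (hv : v ∈ K) (hw : w ∈ K) (hz : z ∈ K)
    (huv₁ : u.1 = v.1 + r) (huv₂ : u.2 = v.2) (hwz : w.2 = z.2 + H) :
    ∃ u' ∈ K, ∃ v' ∈ K, ∃ k : ℤ, u'.1 = v'.1 + ρ * k ∧ u'.2 = v'.2 + ρ := by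
  have hρH : ρ < H := by
    by_contra hcon
    push Not at hcon
    nlinarith [mul_pos hρ hH, mul_pos hr hH]
  set θ := ρ / H with hθ
  have hθ0 : 0 ≤ θ := by positivity
  have hθ1 : 0 < 1 - θ := by rw [hθ, sub_pos, div_lt_one hH]; exact hρH
  have hθH : θ * H = ρ := by rw [hθ]; field_simp
  -- The difference set `K - K` contains the horizontal segment of half-length `r` about `0` and the
  -- vector `w - z` at height `H`. Its slice at height `ρ = θ * H` thus has length at least `2 * (1
  -- - θ) * r ≥ ρ` and contains a multiple of `ρ`.
  have hlen : ρ ≤ 2 * ((1 - θ) * r) := by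
    have : ρ * H ≤ 2 * ((1 - θ) * r) * H := by
      have e : 2 * ((1 - θ) * r) * H = 2 * r * H - 2 * r * (θ * H) := by ring
      rw [e, hθH]; linarith
    exact le_of_mul_le_mul_right this hH
  have hm : 0 < (1 - θ) * r := by positivity
  set k := ⌊(θ * (w.1 - z.1) + (1 - θ) * r) / ρ⌋ with hk
  have hk1 : ρ * k ≤ θ * (w.1 - z.1) + (1 - θ) * r := by
    have := Int.floor_le ((θ * (w.1 - z.1) + (1 - θ) * r) / ρ)
    rw [← hk, le_div_iff₀ hρ] at this
    linarith
  have hk2 : θ * (w.1 - z.1) + (1 - θ) * r < ρ * k + ρ := by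
    have := Int.lt_floor_add_one ((θ * (w.1 - z.1) + (1 - θ) * r) / ρ)
    rw [← hk, div_lt_iff₀ hρ] at this
    linarith
  set s := (ρ * k - θ * (w.1 - z.1)) / ((1 - θ) * r) with hs
  have hs1 : s ≤ 1 := by rw [hs, div_le_one hm]; linarith
  have hs2 : -1 ≤ s := by rw [hs, le_div_iff₀ hm]; linarith
  have hsm : (1 - θ) * (s * r) = ρ * k - θ * (w.1 - z.1) := by
    have : s * ((1 - θ) * r) = ρ * k - θ * (w.1 - z.1) := by rw [hs]; field_simp
    linarith
  -- These two points of the chord differ by `s * r`, with `s ∈ [-1, 1]` chosen to reach `ρ * k`.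
  have hp := hK hu hv (a := (1 + s) / 2) (b := (1 - s) / 2) (by linarith) (by linarith) (by ring)
  have hp' := hK hu hv (a := (1 - s) / 2) (b := (1 + s) / 2) (by linarith) (by linarith) (by ring)
  refine ⟨_, hK hw hp hθ0 hθ1.le (by ring), _, hK hz hp' hθ0 hθ1.le (by ring), k, ?_, ?_⟩
  · simp only [Prod.fst_add, Prod.smul_fst, smul_eq_mul]
    rw [huv₁]
    linear_combination hsm
  · simp only [Prod.snd_add, Prod.smul_snd, smul_eq_mul]
    rw [huv₂, hwz]
    linear_combination hθH

theorem exists_smaller_overlap {K : Set (ℝ × ℝ)} (hK : Convex ℝ K) {r ρ : ℝ} (hr : 0 < r)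
    (hρ : 0 ≤ ρ) (hρr : ρ ≤ r) {u v : ℝ × ℝ} (hu : u ∈ K) (hv : v ∈ K) {a b : ℝ}
    (h1 : u.1 = v.1 + r * a) (h2 : u.2 = v.2 + r * b) :
    ∃ w ∈ K, w.1 = v.1 + ρ * a ∧ w.2 = v.2 + ρ * b := by
  refine ⟨_, hK hu hv (a := ρ / r) (b := 1 - ρ / r) (by positivity) ?_ (by ring), ?_, ?_⟩
  · rw [sub_nonneg, div_le_one hr]; exact hρr
  · simp [h1]; field_simp; ring
  · simp [h2]; field_simp; ring

/-! ### Unimodular changes of coordinates. -/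

/-- The linear map of the plane with columns `(a, b)` and `(-b', a')`. -/
noncomputable def columnMap (a b a' b' : ℤ) : ℝ × ℝ →ₗ[ℝ] ℝ × ℝ :=
  LinearMap.prod ((a : ℝ) • LinearMap.fst ℝ ℝ ℝ - (b' : ℝ) • LinearMap.snd ℝ ℝ ℝ)
    ((b : ℝ) • LinearMap.fst ℝ ℝ ℝ + (a' : ℝ) • LinearMap.snd ℝ ℝ ℝ)

theorem columnMap_apply (a b a' b' : ℤ) (p : ℝ × ℝ) :
    columnMap a b a' b' p = (a * p.1 - b' * p.2, b * p.1 + a' * p.2) := by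
  simp [columnMap]

theorem columnMap_inverse {a b a' b' : ℤ} (h : a * a' + b * b' = 1) (x y : ℝ) :
    columnMap a b a' b' (a' * x + b' * y, -b * x + a * y) = (x, y) := by
  have hR : (a : ℝ) * a' + b * b' = 1 := by exact_mod_cast h
  rw [columnMap_apply]
  ext
  · simp only; linear_combination x * hR
  · simp only; linear_combination y * hR

theorem columnMap_overlap {a b a' b' : ℤ} {q : ℝ} {u v : ℝ × ℝ} {i j : ℤ}
    (h1 : u.1 = v.1 + q * i) (h2 : u.2 = v.2 + q * j) :
    (columnMap a b a' b' u).1 = (columnMap a b a' b' v).1 + q * ((a * i - b' * j : ℤ) : ℝ) ∧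
    (columnMap a b a' b' u).2 = (columnMap a b a' b' v).2 + q * ((b * i + a' * j : ℤ) : ℝ) := by
  simp only [columnMap_apply, h1, h2]
  push_cast
  constructor <;> ring

theorem eq_zero_of_columns {a b a' b' : ℤ} (h : a * a' + b * b' = 1) {i j : ℤ}
    (h1 : a * i - b' * j = 0) (h2 : b * i + a' * j = 0) : i = 0 ∧ j = 0 := by
  constructor
  · linear_combination a' * h1 + b' * h2 - i * h
  · linear_combination a * h2 - b * h1 - j * h

/-- Coordinates of an integer point with respect to the columns of `columnMap a b a' b'`. -/
def columnCoords (a b a' b' : ℤ) (s : ℤ × ℤ) : ℤ × ℤ := (a' * s.1 + b' * s.2, -b * s.1 + a * s.2)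

theorem columnMap_columnCoords {a b a' b' : ℤ} (h : a * a' + b * b' = 1) (s : ℤ × ℤ) :
    columnMap a b a' b' (((columnCoords a b a' b' s).1 : ℝ), ((columnCoords a b a' b' s).2 : ℝ)) =
      ((s.1 : ℝ), (s.2 : ℝ)) := by
  rw [← columnMap_inverse h (s.1 : ℝ) (s.2 : ℝ)]
  simp [columnCoords]

theorem columnCoords_injective {a b a' b' : ℤ} (h : a * a' + b * b' = 1) :
    Function.Injective (columnCoords a b a' b') := by
  intro s t hst
  simp only [columnCoords, Prod.mk.injEq] at hst
  refine Prod.ext ?_ ?_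
  · linear_combination a * hst.1 - b' * hst.2 + (t.1 - s.1) * h
  · linear_combination b * hst.1 + a' * hst.2 + (t.2 - s.2) * h

/-! ### One compact convex set and its holes. -/

/-- The factors `r` of a compact range for which `r • (a, b)` is a difference of `K` for some
nonzero integer vector `(a, b)` form a compact set. -/
theorem isCompact_overlap_factors {K : Set (ℝ × ℝ)} (hKc : IsCompact K) {p q : ℝ} (hp : 0 < p) :
    IsCompact {r : ℝ | r ∈ Set.Icc p q ∧ ∃ a b : ℤ, (a, b) ≠ (0, 0) ∧
      ∃ u ∈ K, ∃ v ∈ K, u.1 = v.1 + r * a ∧ u.2 = v.2 + r * b} := by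
  obtain ⟨M, hM⟩ := hKc.isBounded.exists_norm_le
  set F : Set (ℤ × ℤ) := (Set.Icc (-⌈2 * M / p⌉) ⌈2 * M / p⌉ ×ˢ
    Set.Icc (-⌈2 * M / p⌉) ⌈2 * M / p⌉) \ {(0, 0)} with hF
  have hFfin : F.Finite := ((Set.finite_Icc _ _).prod (Set.finite_Icc _ _)).subset Set.sdiff_subset
  have hcomp : ∀ c : ℤ × ℤ, IsCompact (Prod.fst '' ((Set.Icc p q ×ˢ K) ∩
      {z : ℝ × (ℝ × ℝ) | (z.2.1 + z.1 * c.1, z.2.2 + z.1 * c.2) ∈ K})) := by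
    intro c
    refine IsCompact.image ?_ continuous_fst
    refine (isCompact_Icc.prod hKc).inter_right ?_
    exact hKc.isClosed.preimage (by fun_prop)
  convert hFfin.isCompact_biUnion (fun c _ => hcomp c) using 1
  have hbound : ∀ r : ℝ, p ≤ r → ∀ c : ℤ, ∀ x y : ℝ, |x| ≤ M → |y| ≤ M → x = y + r * c →
      c ∈ Set.Icc (-⌈2 * M / p⌉) ⌈2 * M / p⌉ := by
    intro r hr c x y hx hy hxy
    have h1 : p * |(c : ℝ)| ≤ 2 * M := by
      calc p * |(c : ℝ)| ≤ r * |(c : ℝ)| := by gcongr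
        _ = |x - y| := by rw [hxy, add_sub_cancel_left, abs_mul, abs_of_pos (hp.trans_le hr)]
        _ ≤ 2 * M := by have := abs_sub x y; linarith
    have h2 : |(c : ℝ)| ≤ ⌈2 * M / p⌉ := by
      refine le_trans ?_ (Int.le_ceil _)
      rw [le_div_iff₀ hp]; linarith
    have h3 : |c| ≤ ⌈2 * M / p⌉ := by exact_mod_cast h2
    exact abs_le.1 h3
  ext r
  simp only [Set.mem_ofPred_eq, Set.mem_iUnion, Set.mem_image, Set.mem_inter_iff, Set.mem_prod]
  constructor
  · rintro ⟨hr, a, b, hab, u, hu, v, hv, h1, h2⟩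
    have hu' := hM u hu
    have hv' := hM v hv
    rw [Prod.norm_def, max_le_iff] at hu' hv'
    refine ⟨(a, b), ⟨⟨hbound r hr.1 a _ _ hu'.1 hv'.1 h1, hbound r hr.1 b _ _ hu'.2 hv'.2 h2⟩,
      hab⟩, (r, v), ⟨⟨hr, hv⟩, ?_⟩, rfl⟩
    simp only
    rw [← h1, ← h2]
    exact hu
  · rintro ⟨c, hc, z, ⟨⟨hr, hv⟩, hu⟩, rfl⟩
    exact ⟨hr, c.1, c.2, hc.2, _, hu, _, hv, rfl, rfl⟩

/-- It suffices to find coordinates in which the height is below `2 * q₂`. A horizontal `q₂`-overlap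
forces this in the given ones. Without `q₂`-overlaps, the direction of the largest overlap factor in
`[q₃, q₂]` is made horizontal; if there is no `q₃`-overlap either, points and holes are all
incongruent modulo `q₃`. -/
theorem card_add_card_holes_le {K : Set (ℝ × ℝ)} (hK : Convex ℝ K) (hKc : IsCompact K)
    {q₁ q₂ q₃ : ℕ} (h3 : 0 < q₃) (h32 : q₃ ≤ q₂) (h21 : q₂ ≤ q₁)
    (hQ : ∀ u ∈ K, ∀ v ∈ K, ∀ a b : ℤ, u.1 = v.1 + q₁ * a → u.2 = v.2 + q₁ * b → a = 0 ∧ b = 0)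
    (hq : ∀ u ∈ K, ∀ v ∈ K, ∀ a b : ℤ, u.1 = v.1 + q₂ * a → u.2 = v.2 + q₂ * b → b = 0)
    (S P : Finset (ℤ × ℤ)) (hS : ∀ s ∈ S, ((s.1 : ℝ), (s.2 : ℝ)) ∈ K)
    (hP : ∀ p ∈ P, ∀ p' ∈ P, ∀ a b : ℤ, p.1 = p'.1 + q₃ * a → p.2 = p'.2 + q₃ * b → p = p')
    (hPK : ∀ p ∈ P, ∀ a b : ℤ, ((p.1 : ℝ) + q₃ * a, (p.2 : ℝ) + q₃ * b) ∉ K) :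
    S.card + P.card ≤ q₁ * q₂ := by
  classical
  have h3R : (0 : ℝ) < q₃ := by exact_mod_cast h3
  have h2R : (0 : ℝ) < q₂ := by exact_mod_cast h3.trans_le h32
  have h32R : (q₃ : ℝ) ≤ q₂ := by exact_mod_cast h32
  have hQ' : ∀ u ∈ K, ∀ v ∈ K, ∀ a : ℤ, u.1 = v.1 + q₁ * a → u.2 = v.2 → a = 0 :=
    fun u hu v hv a h1 h2 => (hQ u hu v hv a 0 h1 (by simpa using h2)).1
  by_cases hF : ∃ u ∈ K, ∃ v ∈ K, ∃ a : ℤ, u.1 = v.1 + q₂ * a ∧ u.2 = v.2 ∧ a ≠ 0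
  · refine card_add_card_holes_le_of_height hK h3 h32 h21 hQ' hq ?_ S P hS hP hPK
    obtain ⟨u, hu, v, hv, a, h1, h2, ha⟩ : ∃ u ∈ K, ∃ v ∈ K, ∃ a : ℤ,
        u.1 = v.1 + q₂ * a ∧ u.2 = v.2 ∧ 0 < a := by
      obtain ⟨u, hu, v, hv, a, h1, h2, ha⟩ := hF
      rcases lt_or_gt_of_ne ha with h | h
      · exact ⟨v, hv, u, hu, -a, by push_cast; linarith, h2.symm, by linarith⟩
      · exact ⟨u, hu, v, hv, a, h1, h2, h⟩
    have haR : (1 : ℝ) ≤ a := by exact_mod_cast ha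
    intro w hw z hz
    by_contra hcon
    push Not at hcon
    have hra : (q₂ : ℝ) ≤ q₂ * a := by nlinarith
    -- A chord of length at least `q₂` and a height at least `2 * q₂` would give an overlap `q₂ •
    -- (k, 1)`, which is not horizontal.
    obtain ⟨u', hu', v', hv', k, hk1, hk2⟩ := exists_overlap_of_tall hK (r := q₂ * a)
      (H := w.2 - z.2) (ρ := q₂) (by positivity) h2R (by linarith)
      (by nlinarith [mul_nonneg (sub_nonneg.2 hcon) (sub_nonneg.2 hra),
          mul_nonneg (sub_nonneg.2 hcon) h2R.le, mul_nonneg (sub_nonneg.2 hra) h2R.le])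
      hu hv hw hz h1 h2 (by ring)
    have := hq u' hu' v' hv' k 1 hk1 (by simpa using hk2)
    omega
  have hfull : ∀ u ∈ K, ∀ v ∈ K, ∀ a b : ℤ, u.1 = v.1 + q₂ * a → u.2 = v.2 + q₂ * b →
      a = 0 ∧ b = 0 := by
    intro u hu v hv a b h1 h2
    have hb := hq u hu v hv a b h1 h2
    refine ⟨?_, hb⟩
    by_contra ha
    exact hF ⟨u, hu, v, hv, a, h1, by simpa [hb] using h2, ha⟩
  by_cases hno : ∀ u ∈ K, ∀ v ∈ K, ∀ a b : ℤ, u.1 = v.1 + q₃ * a → u.2 = v.2 + q₃ * b →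
      a = 0 ∧ b = 0
  · have hSP : ∀ s ∈ S, ∀ p ∈ P, ∀ a b : ℤ, s.1 = p.1 + q₃ * a → s.2 = p.2 + q₃ * b → False := by
      intro s hs p hp a b h1 h2
      apply hPK p hp a b
      convert hS s hs using 2
      · rw [h1]; push_cast; ring
      · rw [h2]; push_cast; ring
    have hdisj : Disjoint S P := Finset.disjoint_left.2 fun s hs hp =>
      hSP s hs s hp 0 0 (by simp) (by simp)
    rw [← Finset.card_union_of_disjoint hdisj]
    refine le_trans (card_le_sq_of_incongruent h3 _ ?_) (Nat.mul_le_mul (h32.trans h21) h32)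
    intro p hp p' hp' a b h1 h2
    rcases Finset.mem_union.1 hp with h | h <;> rcases Finset.mem_union.1 hp' with h' | h'
    · have e1 : (p.1 : ℝ) = p'.1 + q₃ * a := by exact_mod_cast h1
      have e2 : (p.2 : ℝ) = p'.2 + q₃ * b := by exact_mod_cast h2
      have := hno _ (hS p h) _ (hS p' h') a b e1 e2
      rw [this.1] at h1
      rw [this.2] at h2
      exact Prod.ext (by simpa using h1) (by simpa using h2)
    · exact (hSP p h p' h' a b h1 h2).elim
    · exact (hSP p' h' p h (-a) (-b) (by rw [h1]; ring) (by rw [h2]; ring)).elim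
    · exact hP p h p' h' a b h1 h2
  push Not at hno
  obtain ⟨u₀, hu₀, v₀, hv₀, a₀, b₀, h10, h20, hab0⟩ := hno
  obtain ⟨r, ⟨hrI, a, b, hab, u, hu, v, hv, h1, h2⟩, hmax⟩ :=
    (isCompact_overlap_factors hKc (p := q₃) (q := q₂) h3R).exists_isGreatest
      ⟨q₃, ⟨le_rfl, h32R⟩, a₀, b₀, by simpa using hab0, u₀, hu₀, v₀, hv₀, h10, h20⟩
  have hr0 : 0 < r := h3R.trans_le hrI.1
  have hr2 : r < q₂ := by
    rcases lt_or_eq_of_le hrI.2 with h | h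
    · exact h
    · rw [h] at h1 h2
      have := hfull u hu v hv a b h1 h2
      exact (hab (by rw [this.1, this.2])).elim
  have hmax' : ∀ ρ : ℝ, r < ρ → ∀ c d : ℤ, (c, d) ≠ (0, 0) → ∀ u ∈ K, ∀ v ∈ K,
      u.1 = v.1 + ρ * c → u.2 = v.2 + ρ * d → False := by
    intro ρ hρ c d hcd u hu v hv h1 h2
    have hρ0 := hr0.trans hρ
    -- Maximality of `r` is known only among factors up to `q₂`, so a larger factor is first shrunk
    -- to `q₂`, which still exceeds `r`.
    obtain ⟨w, hw, hw1, hw2⟩ := exists_smaller_overlap hK hρ0 (ρ := min ρ q₂)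
      (le_min hρ0.le h2R.le) (min_le_left _ _) hu hv h1 h2
    have := hmax (a := min ρ q₂) ⟨⟨le_min (hrI.1.trans hρ.le) h32R, min_le_right _ _⟩, c, d, hcd,
      w, hw, v, hv, hw1, hw2⟩
    exact absurd this (not_le.2 (lt_min hρ hr2))
  -- A common factor of `a` and `b` could be absorbed into `r`, against maximality.
  have hgcd : Int.gcd a b = 1 := by
    have hg0 : Int.gcd a b ≠ 0 := by
      rw [Ne, Int.gcd_eq_zero_iff]
      rintro ⟨rfl, rfl⟩
      exact hab rfl
    by_contra hg1
    have hg2 : (1 : ℝ) < Int.gcd a b := by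
      have : 1 < Int.gcd a b := by omega
      exact_mod_cast this
    obtain ⟨c, hc⟩ := Int.gcd_dvd_left a b
    obtain ⟨d, hd⟩ := Int.gcd_dvd_right a b
    refine hmax' (r * Int.gcd a b) (by nlinarith) c d ?_ u hu v hv ?_ ?_
    · rintro h
      rw [Prod.mk.injEq] at h
      rw [h.1, mul_zero] at hc
      rw [h.2, mul_zero] at hd
      exact hab (by rw [hc, hd])
    · rw [h1]
      have : (a : ℝ) = Int.gcd a b * c := by exact_mod_cast hc
      rw [mul_assoc, ← this]
    · rw [h2]
      have : (b : ℝ) = Int.gcd a b * d := by exact_mod_cast hd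
      rw [mul_assoc, ← this]
  set a' := Int.gcdA a b
  set b' := Int.gcdB a b
  have hdet : a * a' + b * b' = 1 := by
    have := Int.gcd_eq_gcd_ab a b
    rw [hgcd] at this
    exact_mod_cast this.symm
  set f := columnMap a b a' b'
  have hinv : ∀ w : ℝ × ℝ, f (a' * w.1 + b' * w.2, -b * w.1 + a * w.2) = w :=
    fun w => columnMap_inverse hdet w.1 w.2
  have hdetR : (a : ℝ) * a' + b * b' = 1 := by exact_mod_cast hdet
  have key := card_add_card_holes_le_of_height (hK.linear_preimage f) h3 h32 h21
    (by
      intro u hu v hv i e1 e2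
      obtain ⟨e3, e4⟩ := columnMap_overlap (a := a) (b := b) (a' := a') (b' := b') (j := 0) e1
        (by simpa using e2)
      obtain ⟨e5, e6⟩ := hQ _ hu _ hv _ _ e3 e4
      exact (eq_zero_of_columns hdet e5 e6).1)
    (by
      intro u hu v hv i j e1 e2
      obtain ⟨e3, e4⟩ := columnMap_overlap (a := a) (b := b) (a' := a') (b' := b') e1 e2
      obtain ⟨e5, e6⟩ := hfull _ hu _ hv _ _ e3 e4
      exact (eq_zero_of_columns hdet e5 e6).2)
    (by
      intro w hw z hz
      by_contra hcon
      push Not at hcon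
      have hH : 2 * r < w.2 - z.2 := by linarith
      have hH0 : 0 < w.2 - z.2 := by linarith
      -- This `ρ` gives equality in the condition of `exists_overlap_of_tall`, and it exceeds `r`
      -- exactly when the height exceeds `2 * r`; the overlap found contradicts maximality of `r`.
      obtain ⟨u', hu', v', hv', k, hk1, hk2⟩ := exists_overlap_of_tall (hK.linear_preimage f)
        (r := r) (H := w.2 - z.2) (ρ := 2 * r * (w.2 - z.2) / (w.2 - z.2 + 2 * r)) hr0
        (by positivity) hH0 (le_of_eq (by field_simp))
        (u := (a' * u.1 + b' * u.2, -b * u.1 + a * u.2))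
        (v := (a' * v.1 + b' * v.2, -b * v.1 + a * v.2))
        (show f _ ∈ K by rw [hinv]; exact hu) (show f _ ∈ K by rw [hinv]; exact hv) hw hz
        (by simp only [h1, h2]; linear_combination r * hdetR)
        (by simp only [h1, h2]; ring) (by ring)
      obtain ⟨e3, e4⟩ := columnMap_overlap (a := a) (b := b) (a' := a') (b' := b') (j := 1) hk1
        (by simpa using hk2)
      refine hmax' _ ?_ _ _ ?_ _ hu' _ hv' e3 e4
      · rw [lt_div_iff₀ (by positivity)]
        nlinarith
      · intro h
        rw [Prod.mk.injEq] at h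
        have := (eq_zero_of_columns hdet h.1 h.2).2
        omega)
    (S.image (columnCoords a b a' b')) (P.image (columnCoords a b a' b'))
    (by
      simp only [Finset.mem_image]
      rintro _ ⟨s, hs, rfl⟩
      have := hS s hs
      rw [← columnMap_columnCoords hdet s] at this
      exact this)
    (by
      simp only [Finset.mem_image]
      rintro _ ⟨p, hp, rfl⟩ _ ⟨p', hp', rfl⟩ i j e1 e2
      simp only [columnCoords] at e1 e2
      rw [hP p hp p' hp' (a * i - b' * j) (b * i + a' * j)]
      · linear_combination a * e1 - b' * e2 + (p'.1 - p.1) * hdet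
      · linear_combination b * e1 + a' * e2 + (p'.2 - p.2) * hdet)
    (by
      simp only [Finset.mem_image]
      rintro _ ⟨p, hp, rfl⟩ i j hmem
      obtain ⟨e3, e4⟩ := columnMap_overlap (a := a) (b := b) (a' := a') (b' := b') (q := q₃)
        (i := i) (j := j)
        (u := (((columnCoords a b a' b' p).1 : ℝ) + q₃ * i, (columnCoords a b a' b' p).2 + q₃ * j))
        (v := (((columnCoords a b a' b' p).1 : ℝ), ((columnCoords a b a' b' p).2 : ℝ))) rfl rfl
      rw [columnMap_columnCoords hdet] at e3 e4
      apply hPK p hp (a * i - b' * j) (b * i + a' * j)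
      rw [← e3, ← e4]
      exact hmem)
  rwa [Finset.card_image_of_injective _ (columnCoords_injective hdet),
    Finset.card_image_of_injective _ (columnCoords_injective hdet)] at key

/-! ### Families of pairwise disjoint sets modulo `q₃ • ℤ²`. -/

/-- Convex sets that do not meet modulo `q • ℤ²` have parallel self-overlaps. -/
theorem det_eq_zero_of_overlaps {K L : Set (ℝ × ℝ)} (hK : Convex ℝ K) (hL : Convex ℝ L) {q : ℕ}
    (hq : 0 < q)
    (hd : ∀ u ∈ K, ∀ v ∈ L, ∀ a b : ℤ, u.1 = v.1 + q * a → u.2 = v.2 + q * b → False)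
    {a b c d : ℤ} {u v w z : ℝ × ℝ} (hu : u ∈ K) (hv : v ∈ K) (hw : w ∈ L) (hz : z ∈ L)
    (h1 : u.1 = v.1 + q * a) (h2 : u.2 = v.2 + q * b)
    (h3 : w.1 = z.1 + q * c) (h4 : w.2 = z.2 + q * d) : a * d - b * c = 0 := by
  by_contra hdet
  have hdetR : (a : ℝ) * d - b * c ≠ 0 := by exact_mod_cast hdet
  have hqR : (q : ℝ) ≠ 0 := by positivity
  set x := (z.1 - v.1) / q with hx
  set y := (z.2 - v.2) / q with hy
  have hx' : z.1 = v.1 + q * x := by rw [hx]; field_simp; ring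
  have hy' : z.2 = v.2 + q * y := by rw [hy]; field_simp; ring
  -- By Cramer's rule, the lines `v + q s (a, b)` and `z + q t (c, d)` cross at these parameters.
  -- Replacing `s` and `t` by their fractional parts moves the two points by vectors of `q • ℤ²`
  -- onto the segments, so into `K` and `L`.
  set s := (x * d - y * c) / ((a : ℝ) * d - b * c) with hs
  set t := (x * b - y * a) / ((a : ℝ) * d - b * c) with ht
  have hsD : s * ((a : ℝ) * d - b * c) = x * d - y * c := div_mul_cancel₀ _ hdetR
  have htD : t * ((a : ℝ) * d - b * c) = x * b - y * a := div_mul_cancel₀ _ hdetR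
  have e1 : s * a - t * c = x := mul_right_cancel₀ hdetR (by linear_combination a * hsD - c * htD)
  have e2 : s * b - t * d = y := mul_right_cancel₀ hdetR (by linear_combination b * hsD - d * htD)
  have hp := hK hu hv (Int.fract_nonneg s) (sub_nonneg.2 (Int.fract_lt_one s).le) (by ring)
  have hp' := hL hw hz (Int.fract_nonneg t) (sub_nonneg.2 (Int.fract_lt_one t).le) (by ring)
  have fs := Int.self_sub_floor s
  have ft := Int.self_sub_floor t
  refine hd _ hp _ hp' (⌊t⌋ * c - ⌊s⌋ * a) (⌊t⌋ * d - ⌊s⌋ * b) ?_ ?_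
  · simp only [Prod.fst_add, Prod.smul_fst, smul_eq_mul]
    rw [h1, h3, hx', ← fs, ← ft, ← e1]
    push_cast; ring
  · simp only [Prod.snd_add, Prod.smul_snd, smul_eq_mul]
    rw [h2, h4, hy', ← fs, ← ft, ← e2]
    push_cast; ring

theorem card_le_of_planar_family {ι : Type*} (K : ι → Set (ℝ × ℝ)) (hK : ∀ j, Convex ℝ (K j))
    (hKc : ∀ j, IsCompact (K j)) {q₁ q₂ q₃ : ℕ} (h3 : 0 < q₃) (h32 : q₃ ≤ q₂) (h21 : q₂ ≤ q₁)
    (hQ : ∀ j, ∀ u ∈ K j, ∀ v ∈ K j, ∀ a b : ℤ, u.1 = v.1 + q₁ * a → u.2 = v.2 + q₁ * b →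
      a = 0 ∧ b = 0)
    (hq : ∀ j, ∀ u ∈ K j, ∀ v ∈ K j, ∀ a b : ℤ, u.1 = v.1 + q₂ * a → u.2 = v.2 + q₂ * b → b = 0)
    (hd : ∀ j l, j ≠ l → ∀ u ∈ K j, ∀ v ∈ K l, ∀ a b : ℤ,
      u.1 = v.1 + q₃ * a → u.2 = v.2 + q₃ * b → False)
    (S : Finset (ι × ℤ × ℤ)) (hS : ∀ s ∈ S, ((s.2.1 : ℝ), (s.2.2 : ℝ)) ∈ K s.1) :
    S.card ≤ q₁ * q₂ := by
  classical
  -- At most one set has `q₃`-overlaps: the points of all the others become the holes of `K j₀`.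
  by_cases hone : ∃ j₀, ∀ j, j ≠ j₀ → ∀ u ∈ K j, ∀ v ∈ K j, ∀ a b : ℤ,
      u.1 = v.1 + q₃ * a → u.2 = v.2 + q₃ * b → a = 0 ∧ b = 0
  · obtain ⟨j₀, hj₀⟩ := hone
    have hinj₁ : Set.InjOn (fun s : ι × ℤ × ℤ => s.2) (S.filter (fun s => s.1 = j₀)) := by
      intro s hs t ht hst
      rw [Finset.mem_coe, Finset.mem_filter] at hs ht
      exact Prod.ext (hs.2.trans ht.2.symm) hst
    have key : ∀ s ∈ S, ∀ t ∈ S, s.1 ≠ j₀ → t.1 ≠ j₀ → ∀ a b : ℤ, s.2.1 = t.2.1 + q₃ * a →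
        s.2.2 = t.2.2 + q₃ * b → s = t := by
      intro s hs t ht hsj htj a b h1 h2
      have e1 : (s.2.1 : ℝ) = t.2.1 + q₃ * a := by exact_mod_cast h1
      have e2 : (s.2.2 : ℝ) = t.2.2 + q₃ * b := by exact_mod_cast h2
      by_cases hst : s.1 = t.1
      · have hsK := hS s hs
        rw [hst] at hsK
        obtain ⟨rfl, rfl⟩ := hj₀ _ htj _ hsK _ (hS t ht) a b e1 e2
        exact Prod.ext hst (Prod.ext (by simpa using h1) (by simpa using h2))
      · exact (hd _ _ hst _ (hS s hs) _ (hS t ht) a b e1 e2).elim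
    have hinj₂ : Set.InjOn (fun s : ι × ℤ × ℤ => s.2) (S.filter (fun s => ¬ s.1 = j₀)) := by
      intro s hs t ht hst
      rw [Finset.mem_coe, Finset.mem_filter] at hs ht
      simp only at hst
      exact key s hs.1 t ht.1 hs.2 ht.2 0 0 (by simp [hst]) (by simp [hst])
    rw [← Finset.card_filter_add_card_filter_not (s := S) (fun s => s.1 = j₀),
      ← Finset.card_image_of_injOn hinj₁, ← Finset.card_image_of_injOn hinj₂]
    refine card_add_card_holes_le (hK j₀) (hKc j₀) h3 h32 h21 (hQ j₀) (hq j₀) _ _ ?_ ?_ ?_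
    · simp only [Finset.mem_image, Finset.mem_filter]
      rintro _ ⟨s, ⟨hs, rfl⟩, rfl⟩
      exact hS s hs
    · simp only [Finset.mem_image, Finset.mem_filter]
      rintro _ ⟨s, ⟨hs, hsj⟩, rfl⟩ _ ⟨t, ⟨ht, htj⟩, rfl⟩ a b h1 h2
      rw [key s hs t ht hsj htj a b h1 h2]
    · simp only [Finset.mem_image, Finset.mem_filter]
      rintro _ ⟨s, ⟨hs, hsj⟩, rfl⟩ a b hmem
      exact hd _ _ (Ne.symm hsj) _ hmem _ (hS s hs) a b rfl rfl
  push Not at hone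
  rcases S.eq_empty_or_nonempty with rfl | ⟨s₀, hs₀⟩
  · simp
  obtain ⟨j₁, -, u₁, hu₁, v₁, hv₁, a₁, b₁, h11, h12, hne₁⟩ := hone s₀.1
  obtain ⟨j₂, hj₂, u₂, hu₂, v₂, hv₂, a₂, b₂, h21', h22, hne₂⟩ := hone j₁
  have hg0 : Int.gcd a₁ b₁ ≠ 0 := by
    rw [Ne, Int.gcd_eq_zero_iff]
    rintro ⟨h, h'⟩
    exact hne₁ h h'
  obtain ⟨a, ha⟩ := Int.gcd_dvd_left a₁ b₁
  obtain ⟨b, hb⟩ := Int.gcd_dvd_right a₁ b₁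
  set g := Int.gcd a₁ b₁ with hg
  have hg0' : (g : ℤ) ≠ 0 := by exact_mod_cast hg0
  set a' := Int.gcdA a₁ b₁
  set b' := Int.gcdB a₁ b₁
  have hdet : a * a' + b * b' = 1 := by
    have := Int.gcd_eq_gcd_ab a₁ b₁
    apply mul_left_cancel₀ hg0'
    rw [mul_one, mul_add, ← mul_assoc, ← mul_assoc, ← ha, ← hb]
    exact this.symm
  have hpar₁ : ∀ c d : ℤ, a₁ * d - b₁ * c = 0 → a * d - b * c = 0 := by
    intro c d h
    rw [ha, hb] at h
    apply mul_left_cancel₀ hg0'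
    linear_combination h
  have hpar₂ := det_eq_zero_of_overlaps (hK j₁) (hK j₂) h3 (hd _ _ hj₂.symm) hu₁ hv₁ hu₂ hv₂
    h11 h12 h21' h22
  -- Overlaps of the sets other than `K j₁` are compared with the one of `K j₁`; those of `K j₁`
  -- itself need the second set `K j₂` as intermediary.
  have hpar : ∀ j, ∀ u ∈ K j, ∀ v ∈ K j, ∀ c d : ℤ, u.1 = v.1 + q₃ * c → u.2 = v.2 + q₃ * d →
      a * d - b * c = 0 := by
    intro j u hu v hv c d e1 e2
    by_cases hj : j = j₁
    · subst hj
      have h := det_eq_zero_of_overlaps (hK j) (hK j₂) h3 (hd _ _ hj₂.symm) hu hv hu₂ hv₂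
        e1 e2 h21' h22
      have h' := hpar₁ _ _ hpar₂
      have k1 : a₂ * (a * d - b * c) = 0 := by linear_combination c * h' - a * h
      have k2 : b₂ * (a * d - b * c) = 0 := by linear_combination d * h' - b * h
      by_contra hcon
      exact hne₂ ((mul_eq_zero.1 k1).resolve_right hcon) ((mul_eq_zero.1 k2).resolve_right hcon)
    · exact hpar₁ _ _ (det_eq_zero_of_overlaps (hK j₁) (hK j) h3 (hd _ _ (Ne.symm hj))
        hu₁ hv₁ hu hv h11 h12 e1 e2)
  set f := columnMap a b a' b'
  have key := card_le_of_parallel (fun j => f ⁻¹' K j) (fun j => (hK j).linear_preimage f) h3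
    (h32.trans h21)
    (by
      intro j u hu v hv i e1 e2
      obtain ⟨e3, e4⟩ := columnMap_overlap (a := a) (b := b) (a' := a') (b' := b') (j := 0) e1
        (by simpa using e2)
      obtain ⟨e5, e6⟩ := hQ j _ hu _ hv _ _ e3 e4
      exact (eq_zero_of_columns hdet e5 e6).1)
    (by
      intro j u hu v hv i k e1 e2
      obtain ⟨e3, e4⟩ := columnMap_overlap (a := a) (b := b) (a' := a') (b' := b') e1 e2
      have := hpar j _ hu _ hv _ _ e3 e4
      linear_combination this - k * hdet)
    (by
      intro j l hjl u hu v hv i k e1 e2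
      obtain ⟨e3, e4⟩ := columnMap_overlap (a := a) (b := b) (a' := a') (b' := b') e1 e2
      exact hd j l hjl _ hu _ hv _ _ e3 e4)
    (S.image (fun s => (s.1, columnCoords a b a' b' s.2)))
    (by
      simp only [Finset.mem_image]
      rintro _ ⟨s, hs, rfl⟩
      have := hS s hs
      rw [← columnMap_columnCoords hdet s.2] at this
      exact this)
  rw [Finset.card_image_of_injective _ (fun s t hst => by
    simp only [Prod.mk.injEq] at hst
    exact Prod.ext hst.1 (columnCoords_injective hdet hst.2))] at key
  exact key.trans (Nat.mul_le_mul le_rfl h32)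

/-! ### From lattices to integer coordinates. -/

/-- The uniform bound on finite subfamilies also forces each `T j` to be finite, so the value `⊤`
cannot occur. -/
theorem sum_encard_le {n : ℕ} {α : Type*} (T : Fin n → Set α) (N : ℕ)
    (h : ∀ S : Finset (Fin n × α), (∀ s ∈ S, s.2 ∈ T s.1) → S.card ≤ N) :
    ∑ j, (T j).encard ≤ (N : ℕ∞) := by
  classical
  have hfin : ∀ j, (T j).Finite := by
    intro j
    by_contra hinf
    obtain ⟨s, hs, hcard⟩ := Set.Infinite.exists_subset_card_eq hinf (N + 1)
    have := h (s.image (fun x => (j, x))) (by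
      simp only [Finset.mem_image]
      rintro _ ⟨x, hx, rfl⟩
      exact hs hx)
    rw [Finset.card_image_of_injective _ (Prod.mk_right_injective j)] at this
    omega
  have hS := h ((Finset.univ.sigma (fun j => (hfin j).toFinset)).map
    (Equiv.sigmaEquivProd (Fin n) α).toEmbedding) (by
      simp only [Finset.mem_map, Finset.mem_sigma]
      rintro _ ⟨s, hs, rfl⟩
      simpa using hs.2)
  rw [Finset.card_map, Finset.card_sigma] at hS
  calc ∑ j, (T j).encard = ∑ j, ((hfin j).toFinset.card : ℕ∞) := by
        refine Finset.sum_congr rfl fun j _ => ?_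
        exact (hfin j).encard_eq_coe_toFinset_card
    _ ≤ (N : ℕ∞) := by exact_mod_cast hS

theorem mem_initialSublattice_zero {d : ℕ} {Λ : Submodule ℤ (EuclideanSpace ℝ (Fin d))}
    (e : Module.Basis (Fin d) ℤ Λ) {x : EuclideanSpace ℝ (Fin d)}
    (hx : x ∈ initialSublattice e 0) : x = 0 := by
  simpa [initialSublattice] using hx

theorem false_of_inter_smul_eq_empty {E : Type*} [AddCommGroup E] [Module ℝ E] {A B L : Set E}
    {r : ℝ} (h : (A - B) ∩ r • L = ∅) {x y z : E} (hx : x ∈ A) (hy : y ∈ B) (hz : z ∈ L)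
    (he : x = y + r • z) : False := by
  have hmem : r • z ∈ (A - B) ∩ r • L :=
    ⟨Set.mem_sub.2 ⟨x, hx, y, hy, by rw [he]; abel⟩, Set.smul_mem_smul_set hz⟩
  rw [h] at hmem
  exact hmem

/-- The line is placed as the horizontal axis of the plane, where all points lie in row `0` and
`card_le_of_row_class` applies. -/
theorem sum_latticeCount_le_one (Λ : Submodule ℤ (EuclideanSpace ℝ (Fin 1)))
    (e : Module.Basis (Fin 1) ℤ Λ)
    (n : ℕ) (K : Fin n → Set (EuclideanSpace ℝ (Fin 1))) (hK : ∀ j, Convex ℝ (K j))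
    (q : Fin 2 → ℕ) (hq_pos : ∀ i, 0 < q i) (hq_anti : Antitone q)
    (h1 : ∀ (j : Fin n) (i : Fin 1), differenceBody (K j) ∩
      (q i.castSucc : ℝ) • ((Λ : Set (EuclideanSpace ℝ (Fin 1))) \
        (initialSublattice e i : Set (EuclideanSpace ℝ (Fin 1)))) = ∅)
    (h2 : ∀ j l : Fin n, j ≠ l →
      (K j - K l) ∩ (q 1 : ℝ) • (Λ : Set (EuclideanSpace ℝ (Fin 1))) = ∅) :
    ∑ j, latticeCount (K j) Λ ≤ (q 0 : ℕ∞) := by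
  set φ : ℝ × ℝ →ₗ[ℝ] EuclideanSpace ℝ (Fin 1) :=
    (LinearMap.fst ℝ ℝ ℝ).smulRight (e 0 : EuclideanSpace ℝ (Fin 1)) with hφ
  have hφa : ∀ p, φ p = p.1 • (e 0 : EuclideanSpace ℝ (Fin 1)) := fun p => rfl
  set L : Fin n → Set (ℝ × ℝ) := fun j => φ ⁻¹' K j ∩ (LinearMap.snd ℝ ℝ ℝ) ⁻¹' {0} with hL
  have hmemL : ∀ j p, p ∈ L j ↔ p.1 • (e 0 : EuclideanSpace ℝ (Fin 1)) ∈ K j ∧ p.2 = 0 :=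
    fun j p => Iff.rfl
  have he0 : (e 0 : EuclideanSpace ℝ (Fin 1)) ≠ 0 := by
    have := e.ne_zero 0
    exact fun h => this (Subtype.ext h)
  have hsmul : ∀ a : ℤ, ((a : ℝ) • (e 0 : EuclideanSpace ℝ (Fin 1))) ∈ Λ := by
    intro a
    rw [Int.cast_smul_eq_zsmul]
    exact Λ.smul_mem a (e 0).2
  have hcount : ∀ j, latticeCount (K j) Λ ≤
      {z : ℤ × ℤ | ((z.1 : ℝ), (z.2 : ℝ)) ∈ L j}.encard := by
    intro j
    refine le_trans (Set.encard_le_encard ?_) (Set.encard_image_le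
      (fun z : ℤ × ℤ => (z.1 : ℝ) • (e 0 : EuclideanSpace ℝ (Fin 1))) _)
    rintro x ⟨hxK, hxΛ⟩
    have hrepr := e.sum_repr ⟨x, hxΛ⟩
    have hx : ((e.repr ⟨x, hxΛ⟩ 0 : ℤ) : ℝ) • (e 0 : EuclideanSpace ℝ (Fin 1)) = x := by
      rw [Int.cast_smul_eq_zsmul]
      simpa using congrArg Subtype.val hrepr
    exact ⟨(e.repr ⟨x, hxΛ⟩ 0, 0), ⟨by simpa [hφa, hx] using hxK, by simp⟩, hx⟩
  refine (Finset.sum_le_sum fun j _ => hcount j).trans ?_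
  refine sum_encard_le _ _ fun S hS => ?_
  refine card_le_of_row_class L (fun j => ((hK j).linear_preimage φ).inter
    ((convex_singleton 0).linear_preimage _)) (hq_pos 1) (hq_anti (by simp)) ?_ ?_ ?_ 0 S hS ?_
  · intro j u hu v hv a e1 _
    by_contra ha
    refine false_of_inter_smul_eq_empty (h1 j 0) hu.1 hv.1 ⟨hsmul a, fun h => ?_⟩ ?_
    · have := mem_initialSublattice_zero e h
      rw [smul_eq_zero] at this
      rcases this with h | h
      · exact ha (by exact_mod_cast h)
      · exact he0 h
    · rw [hφa, hφa, e1, add_smul, mul_smul]; rfl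
  · intro j u hu v hv a b _ e2
    rw [((hmemL _ _).1 hu).2, ((hmemL _ _).1 hv).2, zero_add] at e2
    have hq1 : (q 1 : ℝ) ≠ 0 := by exact_mod_cast (hq_pos 1).ne'
    have := (mul_eq_zero.1 e2.symm).resolve_left hq1
    exact_mod_cast this
  · intro j l hjl u hu v hv a b e1 _
    refine false_of_inter_smul_eq_empty (h2 j l hjl) hu.1 hv.1 (hsmul a) ?_
    rw [hφa, hφa, e1, add_smul, mul_smul]
  · intro s hs
    have := ((hmemL _ _).1 (hS s hs)).2
    simp only [Int.cast_eq_zero] at this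
    simp [this]

/-- The basis identifies `ℤ²` with `Λ`. The first-level condition excludes all `q 0`-overlaps, and
the second, with `Λ¹` the multiples of `e 0`, leaves only horizontal `q 1`-overlaps. -/
theorem sum_latticeCount_le_two (Λ : Submodule ℤ (EuclideanSpace ℝ (Fin 2)))
    [DiscreteTopology Λ] [IsZLattice ℝ Λ] (e : Module.Basis (Fin 2) ℤ Λ)
    (n : ℕ) (K : Fin n → Set (EuclideanSpace ℝ (Fin 2))) (hK : ∀ j, Convex ℝ (K j))
    (hKc : ∀ j, IsCompact (K j))
    (q : Fin 3 → ℕ) (hq_pos : ∀ i, 0 < q i) (hq_anti : Antitone q)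
    (h1 : ∀ (j : Fin n) (i : Fin 2), differenceBody (K j) ∩
      (q i.castSucc : ℝ) • ((Λ : Set (EuclideanSpace ℝ (Fin 2))) \
        (initialSublattice e i : Set (EuclideanSpace ℝ (Fin 2)))) = ∅)
    (h2 : ∀ j l : Fin n, j ≠ l →
      (K j - K l) ∩ (q 2 : ℝ) • (Λ : Set (EuclideanSpace ℝ (Fin 2))) = ∅) :
    ∑ j, latticeCount (K j) Λ ≤ ((q 0 * q 1 : ℕ) : ℕ∞) := by
  set c₀ : EuclideanSpace ℝ (Fin 2) := (e 0 : EuclideanSpace ℝ (Fin 2)) with hc₀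
  set c₁ : EuclideanSpace ℝ (Fin 2) := (e 1 : EuclideanSpace ℝ (Fin 2)) with hc₁
  have hind : ∀ s t : ℝ, s • c₀ + t • c₁ = 0 → s = 0 ∧ t = 0 := by
    have h := (e.ofZLatticeBasis ℝ Λ).linearIndependent
    rw [Fintype.linearIndependent_iff] at h
    intro s t hst
    have := h ![s, t] (by simpa [Fin.sum_univ_two, Module.Basis.ofZLatticeBasis_apply] using hst)
    exact ⟨this 0, this 1⟩
  set φ : ℝ × ℝ →ₗ[ℝ] EuclideanSpace ℝ (Fin 2) :=
    (LinearMap.fst ℝ ℝ ℝ).smulRight c₀ + (LinearMap.snd ℝ ℝ ℝ).smulRight c₁ with hφ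
  have hφa : ∀ p, φ p = p.1 • c₀ + p.2 • c₁ := fun p => rfl
  have hker : LinearMap.ker φ = ⊥ := by
    rw [LinearMap.ker_eq_bot']
    intro p hp
    have := hind _ _ hp
    exact Prod.ext this.1 this.2
  have hcl := LinearMap.isClosedEmbedding_of_injective hker
  have hmem : ∀ a b : ℤ, φ ((a : ℝ), (b : ℝ)) ∈ Λ := by
    intro a b
    rw [hφa]
    simp only [Int.cast_smul_eq_zsmul]
    exact Λ.add_mem (Λ.smul_mem a (e 0).2) (Λ.smul_mem b (e 1).2)
  have hstep : ∀ (r : ℝ) (u v : ℝ × ℝ) (a b : ℤ), u.1 = v.1 + r * a → u.2 = v.2 + r * b →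
      φ u = φ v + r • φ ((a : ℝ), (b : ℝ)) := by
    intro r u v a b e1 e2
    rw [← map_smul, ← map_add]
    congr 1
    exact Prod.ext (by simpa using e1) (by simpa using e2)
  have hcount : ∀ j, latticeCount (K j) Λ ≤
      {z : ℤ × ℤ | ((z.1 : ℝ), (z.2 : ℝ)) ∈ φ ⁻¹' K j}.encard := by
    intro j
    refine le_trans (Set.encard_le_encard ?_) (Set.encard_image_le
      (fun z : ℤ × ℤ => φ ((z.1 : ℝ), (z.2 : ℝ))) _)
    rintro x ⟨hxK, hxΛ⟩
    have hrepr := e.sum_repr ⟨x, hxΛ⟩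
    have hx : φ (((e.repr ⟨x, hxΛ⟩ 0 : ℤ) : ℝ), ((e.repr ⟨x, hxΛ⟩ 1 : ℤ) : ℝ)) = x := by
      rw [hφa]
      simp only [Int.cast_smul_eq_zsmul]
      rw [Fin.sum_univ_two] at hrepr
      exact congrArg Subtype.val hrepr
    exact ⟨(e.repr ⟨x, hxΛ⟩ 0, e.repr ⟨x, hxΛ⟩ 1), show φ _ ∈ K j by rw [hx]; exact hxK, hx⟩
  refine (Finset.sum_le_sum fun j _ => hcount j).trans ?_
  refine sum_encard_le _ _ fun S hS => ?_
  refine card_le_of_planar_family (fun j => φ ⁻¹' K j) (fun j => (hK j).linear_preimage φ)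
    (fun j => hcl.isCompact_preimage (hKc j)) (hq_pos 2) (hq_anti (by decide))
    (hq_anti (by decide)) ?_ ?_ ?_ S hS
  · intro j u hu v hv a b e1 e2
    by_contra hab
    refine false_of_inter_smul_eq_empty (h1 j 0) hu hv ⟨hmem a b, fun h => hab ?_⟩
      (hstep _ _ _ _ _ e1 e2)
    have := hind _ _ (mem_initialSublattice_zero e h)
    exact ⟨Int.cast_eq_zero.1 this.1, Int.cast_eq_zero.1 this.2⟩
  · intro j u hu v hv a b e1 e2
    by_contra hb
    refine false_of_inter_smul_eq_empty (h1 j 1) hu hv ⟨hmem a b, fun h => hb ?_⟩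
      (hstep _ _ _ _ _ e1 e2)
    have hset : {x : EuclideanSpace ℝ (Fin 2) | ∃ k : Fin 2, (k : ℕ) < ((1 : Fin 2) : ℕ) ∧
        x = (e k : EuclideanSpace ℝ (Fin 2))} = {c₀} := by
      ext x
      simp [hc₀]
    rw [SetLike.mem_coe, initialSublattice, hset, Submodule.mem_span_singleton] at h
    obtain ⟨c, hc⟩ := h
    rw [hφa, ← Int.cast_smul_eq_zsmul ℝ] at hc
    have := (hind (a - c) b (by rw [sub_smul, hc]; simp only; abel)).2
    exact_mod_cast this
  · intro j l hjl u hu v hv a b e1 e2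
    exact false_of_inter_smul_eq_empty (h2 j l hjl) hu hv (hmem a b) (hstep _ _ _ _ _ e1 e2)

end LatticeConvex

theorem mainTheorem2 (d : ℕ) (hd : d = 1 ∨ d = 2)
    (Λ : Submodule ℤ (EuclideanSpace ℝ (Fin d))) [DiscreteTopology Λ] [IsZLattice ℝ Λ]
    (e : Module.Basis (Fin d) ℤ Λ)
    (n : ℕ) (K : Fin n → Set (EuclideanSpace ℝ (Fin d)))
    (hK : ∀ j, LatticeConvex.IsConvexBody (K j))
    -- with indices shifted by one: `q 0 ≥ q 1 ≥ ⋯ ≥ q d` are `q_1 ≥ q_2 ≥ ⋯ ≥ q_{d+1}`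
    (q : Fin (d + 1) → ℕ) (hq_pos : ∀ i, 0 < q i) (hq_anti : Antitone q)
    (h1 : ∀ (j : Fin n) (i : Fin d),
      LatticeConvex.differenceBody (K j) ∩
        (q i.castSucc : ℝ) • ((Λ : Set (EuclideanSpace ℝ (Fin d))) \
          (LatticeConvex.initialSublattice e i : Set (EuclideanSpace ℝ (Fin d)))) = ∅)
    (h2 : ∀ j l : Fin n, j ≠ l →
      (K j - K l) ∩ (q (Fin.last d) : ℝ) • (Λ : Set (EuclideanSpace ℝ (Fin d))) = ∅) :
    ∑ j, LatticeConvex.latticeCount (K j) Λ ≤ ((∏ i : Fin d, q i.castSucc : ℕ) : ℕ∞) := by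
  rcases hd with rfl | rfl
  · simpa using LatticeConvex.sum_latticeCount_le_one Λ e n K (fun j => (hK j).convex) q hq_pos
      hq_anti h1 h2
  · simpa [Fin.prod_univ_two] using LatticeConvex.sum_latticeCount_le_two Λ e n K
      (fun j => (hK j).convex) (fun j => (hK j).isCompact) q hq_pos hq_anti h1 h2
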